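/- An absolutely maximally entangled (AME) state of an $N$-partite system $\mathbb{C}^{d_1}\otimes\mathbb{C}^{d_2}\otimes\cdots\otimes\mathbb{C}^{d_N}$ is a unit vector $|\psi\rangle$ such that, for every set $A\subseteq\{1,\dots,N\}$ of exactly $\lfloor N/2\rfloor$ parties, the reduced density matrix $\rho_A=\operatorname{Tr}_{A^c}|\psi\rangle\langle\psi|$ is maximally mixed, i.e. $\rho_A=\frac{1}{\prod_{i\in A}d_i}I$. Then, for integers $d$ and $n$: (i) there is no AME state in $\mathbb{C}^{d}\otimes(\mathbb{C}^{2})^{\otimes 2n}$ if $d\in\{3,4\}$ and $n\ge 4$; (ii) there is no AME state in $\mathbb{C}^{d}\otimes(\mathbb{C}^{3})^{\otimes 2n}$ if $2\le d\le 8$, $d\ne 3$, $n\ge 6$ and $n\ne 7$; nor if $d=9$, $n\ge 6$ and $n\notin\{7,9\}$. -/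

import Mathlib

namespace MultipartiteSystem

/-- The Hilbert space `⨂ i, ℂ^{d i}` of a system whose parties are indexed by `ι`, where party `i`
has local dimension `d i`, written in the computational basis: `ψ u` is the amplitude at `|u⟩`. -/
abbrev HilbertSpace {ι : Type*} (d : ι → ℕ) : Type _ :=
  EuclideanSpace ℂ ((i : ι) → Fin (d i))

/-- The density matrix `|ψ⟩⟨ψ|`. -/
noncomputable def densityMatrix {ι : Type*} {d : ι → ℕ} (ψ : HilbertSpace d) :
    Matrix ((i : ι) → Fin (d i)) ((i : ι) → Fin (d i)) ℂ :=
  Matrix.of fun u u' => ψ u * star (ψ u')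

/-- The basis label `u` with `u_A = x` and `u_{Aᶜ} = z`. -/
def glue {ι : Type*} [DecidableEq ι] {d : ι → ℕ} (A : Finset ι)
    (x : (i : {i // i ∈ A}) → Fin (d i)) (z : (i : {i // i ∉ A}) → Fin (d i)) :
    (i : ι) → Fin (d i) :=
  (Equiv.piEquivPiSubtypeProd (fun i => i ∈ A) (fun i => Fin (d i))).symm (x, z)

/-- The reduction `ρ_A` of a matrix `ρ` to the parties in `A`: the partial trace over the other
parties. -/
noncomputable def reduction {ι : Type*} [Fintype ι] [DecidableEq ι] {d : ι → ℕ}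
    (ρ : Matrix ((i : ι) → Fin (d i)) ((i : ι) → Fin (d i)) ℂ) (A : Finset ι) :
    Matrix ((i : {i // i ∈ A}) → Fin (d i)) ((i : {i // i ∈ A}) → Fin (d i)) ℂ :=
  Matrix.of fun x y => ∑ z : (i : {i // i ∉ A}) → Fin (d i), ρ (glue A x z) (glue A y z)

/-- A `k`-uniform state: a normalized vector whose reduction to any `k` parties is maximally
mixed. -/
def IsUniformState {ι : Type*} [Fintype ι] [DecidableEq ι] {d : ι → ℕ} (k : ℕ)
    (ψ : HilbertSpace d) : Prop :=
  ‖ψ‖ = 1 ∧ ∀ A : Finset ι, A.card = k →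
    reduction (densityMatrix ψ) A = (1 / ∏ i ∈ A, (d i : ℂ)) • 1

/-- An absolutely maximally entangled state of an `N`-partite system: an `⌊N/2⌋`-uniform state. -/
def IsAME {ι : Type*} [Fintype ι] [DecidableEq ι] {d : ι → ℕ} (ψ : HilbertSpace d) : Prop :=
  IsUniformState (Fintype.card ι / 2) ψ

/-- The local dimensions of `ℂ^{d₁} ⊗ (ℂ^{d₂})^{⊗m}`. -/
def oneAndMany (d₁ d₂ m : ℕ) : Fin (m + 1) → ℕ :=
  fun i => if i = 0 then d₁ else d₂

end MultipartiteSystem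

/-! Maximal mixedness on at most `n` parties, together with purity of the state, fixes the purity of
every set of `D`-dimensional parties as a function of its size (`IsAME.purity_eq`). Two families of
linear inequalities hold for the purities of any state, both from positivity of a Gram matrix:
Rains' shadow inequality (`shadow_nonneg`), from partial swaps of two copies, and nonnegativity of
the weight enumerator (`weight_nonneg`), from local averages of the projector. For an AME state they
become integer inequalities. The weights of sizes `n + 2` and `n + 3` are linear and quadratic in
`n` and leave few values of `n`; those are refuted numerically by shadow inequalities. -/

namespace MultipartiteSystem

open Finset

/-! ### Purities and their inequalities for arbitrary vectors. -/

section Purity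

variable {ι : Type*} [Fintype ι] [DecidableEq ι] {X : ι → Type*} [∀ i, Fintype (X i)]

/-- Exchanging the `A`-parts of two labels permutes the pairs of labels. -/
theorem sum_piecewise_swap {M : Type*} [AddCommMonoid M] (A : Finset ι)
    (f : (∀ i, X i) → (∀ i, X i) → M) :
    ∑ x, ∑ z, f (A.piecewise z x) (A.piecewise x z) = ∑ x, ∑ z, f x z := by
  have hinv : Function.Involutive
      (fun p : (∀ i, X i) × (∀ i, X i) => ((A.piecewise p.2 p.1, A.piecewise p.1 p.2) :
        (∀ i, X i) × (∀ i, X i))) := by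
    intro p
    ext i <;> by_cases hi : i ∈ A <;> simp [hi]
  rw [← Fintype.sum_prod_type', ← Fintype.sum_prod_type']
  exact Equiv.sum_comp hinv.toPerm fun p : (∀ i, X i) × (∀ i, X i) => f p.1 p.2

theorem sum_sum_piecewise {M : Type*} [AddCommMonoid M] (A : Finset ι) (g : (∀ i, X i) → M) :
    ∑ x : ∀ i, X i, ∑ z, g (A.piecewise x z) = Fintype.card (∀ i, X i) • ∑ u, g u := by
  rw [sum_comm, sum_piecewise_swap A (fun x _ => g x)]
  simp [← sum_nsmul]

/-- The expectation of the operator exchanging the `A`-parts of two copies of `ψ`. For a pure state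
this is the purity of the reduction to `A`. -/
noncomputable def purity (ψ : (∀ i, X i) → ℂ) (A : Finset ι) : ℂ :=
  ∑ u, ∑ v, ψ u * ψ v * star (ψ (A.piecewise v u)) * star (ψ (A.piecewise u v))

theorem purity_compl (ψ : (∀ i, X i) → ℂ) (A : Finset ι) : purity ψ Aᶜ = purity ψ A := by
  unfold purity
  refine sum_congr rfl fun u _ => sum_congr rfl fun v _ => ?_
  rw [piecewise_compl, piecewise_compl]
  ring

/-- This is the trace of the squared reduction. All four sums run over full labels, of which only
the `A` part or the complementary part matters; the overcount is the factor on the left. -/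
theorem card_sq_mul_purity (ψ : (∀ i, X i) → ℂ) (A : Finset ι) :
    (Fintype.card (∀ i, X i) : ℂ) ^ 2 * purity ψ A =
      ∑ x, ∑ y, (∑ z, ψ (A.piecewise x z) * star (ψ (A.piecewise y z))) *
        ∑ w, ψ (A.piecewise y w) * star (ψ (A.piecewise x w)) := by
  have key : ∀ x z y w : ∀ i, X i,
      ψ (A.piecewise x z) * star (ψ (A.piecewise y z)) *
        (ψ (A.piecewise y w) * star (ψ (A.piecewise x w))) =
      ψ (A.piecewise x z) * ψ (A.piecewise y w) *
        star (ψ (A.piecewise (A.piecewise y w) (A.piecewise x z))) *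
        star (ψ (A.piecewise (A.piecewise x z) (A.piecewise y w))) := by
    intro x z y w
    rw [piecewise_piecewise_of_subset_left, piecewise_piecewise_of_subset_right,
      piecewise_piecewise_of_subset_left, piecewise_piecewise_of_subset_right] <;> try rfl
    ring
  simp_rw [sum_mul_sum]
  have : ∀ x : ∀ i, X i, (∑ y, ∑ z, ∑ w, ψ (A.piecewise x z) * star (ψ (A.piecewise y z)) *
        (ψ (A.piecewise y w) * star (ψ (A.piecewise x w)))) =
      ∑ z, ∑ y, ∑ w, ψ (A.piecewise x z) * star (ψ (A.piecewise y z)) *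
        (ψ (A.piecewise y w) * star (ψ (A.piecewise x w))) := fun x => sum_comm
  simp_rw [this, key]
  rw [sum_sum_piecewise A (fun u => ∑ y, ∑ w, ψ u * ψ (A.piecewise y w) *
        star (ψ (A.piecewise (A.piecewise y w) u)) * star (ψ (A.piecewise u (A.piecewise y w))))]
  have h2 : ∀ u : ∀ i, X i, (∑ y, ∑ w, ψ u * ψ (A.piecewise y w) *
        star (ψ (A.piecewise (A.piecewise y w) u)) * star (ψ (A.piecewise u (A.piecewise y w)))) =
      Fintype.card (∀ i, X i) •
        ∑ v, ψ u * ψ v * star (ψ (A.piecewise v u)) * star (ψ (A.piecewise u v)) := fun u =>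
    sum_sum_piecewise A (fun v => ψ u * ψ v * star (ψ (A.piecewise v u)) *
      star (ψ (A.piecewise u v)))
  simp_rw [h2, ← smul_sum, nsmul_eq_mul]
  rw [purity]
  ring

/-- Positivity of a Gram matrix. -/
theorem re_sum_sum_nonneg {α β : Type*} [Fintype β] (s : Finset α) (c : α → ℝ)
    (w : α → β → ℂ) (G : α → α → ℂ) (hG : ∀ a b, ∑ x, w a x * star (w b x) = G a b) :
    0 ≤ (∑ a ∈ s, ∑ b ∈ s, (c a * c b : ℂ) * G a b).re := by
  have : ∑ a ∈ s, ∑ b ∈ s, (c a * c b : ℂ) * G a b =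
      ∑ x, (∑ a ∈ s, c a * w a x) * star (∑ a ∈ s, c a * w a x) := by
    simp_rw [← hG, star_sum, sum_mul_sum, mul_sum]
    rw [sum_comm' (s := univ) (t := fun _ => s) (t' := s) (s' := fun _ => univ) (by simp)]
    refine sum_congr rfl fun a _ => ?_
    rw [sum_comm]
    refine sum_congr rfl fun x _ => sum_congr rfl fun b _ => ?_
    rw [star_mul', show star (c b : ℂ) = c b from Complex.conj_ofReal _]
    ring
  rw [this, Complex.re_sum]
  refine sum_nonneg fun x _ => ?_
  rw [Complex.star_def, Complex.mul_conj]
  exact Complex.normSq_nonneg _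

/-- Partial swaps are commuting involutions, and those on `A` and `B` compose to the one on
`symmDiff A B`. -/
theorem gram_swap (ψ : (∀ i, X i) → ℂ) (A B : Finset ι) :
    ∑ p : (∀ i, X i) × (∀ i, X i),
      ψ (A.piecewise p.2 p.1) * ψ (A.piecewise p.1 p.2) *
        star (ψ (B.piecewise p.2 p.1) * ψ (B.piecewise p.1 p.2)) = purity ψ (symmDiff A B) := by
  rw [Fintype.sum_prod_type, purity, ← sum_piecewise_swap A fun u v => ψ u * ψ v *
    star (ψ ((symmDiff A B).piecewise v u)) * star (ψ ((symmDiff A B).piecewise u v))]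
  refine sum_congr rfl fun u _ => sum_congr rfl fun v _ => ?_
  have h : ∀ u v : ∀ i, X i, (symmDiff A B).piecewise (A.piecewise u v) (A.piecewise v u) =
      B.piecewise v u := by
    intro u v
    ext i
    by_cases h1 : i ∈ A <;> by_cases h2 : i ∈ B <;> simp [h1, h2, mem_symmDiff]
  rw [h, h, star_mul']
  ring

/-- Rains' shadow inequality. -/
theorem shadow_nonneg (ψ : (∀ i, X i) → ℂ) (U T : Finset ι) :
    0 ≤ (∑ S ∈ U.powerset, (-1 : ℂ) ^ #(S ∩ T) * purity ψ S).re := by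
  have h := re_sum_sum_nonneg U.powerset (fun S => (-1 : ℝ) ^ #(S ∩ T)) _ _ (gram_swap ψ)
  -- The sign is a character for symmetric difference, so every row of the Gram double sum equals
  -- the single sum claimed.
  have hsign : ∀ A B : Finset ι, (-1 : ℂ) ^ #(symmDiff A B ∩ T) =
      (-1) ^ #(A ∩ T) * (-1) ^ #(B ∩ T) := by
    intro A B
    have hp : ∀ S : Finset ι, (-1 : ℂ) ^ #(S ∩ T) =
        ∏ i, if i ∈ S then (if i ∈ T then (-1 : ℂ) else 1) else 1 := by
      intro S
      simp [← filter_mem_eq_inter]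
    rw [hp, hp, hp, ← prod_mul_distrib]
    refine prod_congr rfl fun i _ => ?_
    by_cases h1 : i ∈ A <;> by_cases h2 : i ∈ B <;> by_cases h3 : i ∈ T <;>
      simp [h1, h2, h3, mem_symmDiff]
  have e : ∀ A ∈ U.powerset, ∑ B ∈ U.powerset,
      (((-1 : ℝ) ^ #(A ∩ T) : ℝ) * ((-1 : ℝ) ^ #(B ∩ T) : ℝ) : ℂ) * purity ψ (symmDiff A B) =
      ∑ S ∈ U.powerset, (-1 : ℂ) ^ #(S ∩ T) * purity ψ S := by
    intro A hA
    rw [mem_powerset] at hA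
    have hmem : ∀ B ∈ U.powerset, symmDiff A B ∈ U.powerset := by
      intro B hB
      rw [mem_powerset] at hB ⊢
      exact symmDiff_le_sup.trans (union_subset hA hB)
    refine sum_nbij' (symmDiff A) (symmDiff A) hmem hmem (by simp) (by simp) ?_
    intro B _
    rw [hsign]
    push_cast
    rfl
  rw [sum_congr rfl e, sum_const, Complex.re_nsmul, nsmul_eq_mul] at h
  exact (mul_nonneg_iff_of_pos_left (by simp)).1 h

variable [∀ i, DecidableEq (X i)]

theorem card_eq_on (A : Finset ι) (x : ∀ i, X i) :
    #{y : ∀ i, X i | ∀ i ∈ A, x i = y i} = ∏ i ∈ Aᶜ, Fintype.card (X i) := by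
  have : ({y : ∀ i, X i | ∀ i ∈ A, x i = y i} : Finset _) =
      Fintype.piFinset (fun i => if i ∈ A then {x i} else univ) := by
    ext y
    simp only [mem_filter, mem_univ, true_and, Fintype.mem_piFinset]
    refine forall_congr' fun i => ?_
    by_cases hi : i ∈ A <;> simp [hi, eq_comm]
  rw [this, Fintype.card_piFinset, ← prod_compl_mul_prod A]
  rw [prod_congr (s₁ := Aᶜ) rfl (g := fun i => Fintype.card (X i)),
    prod_congr (s₁ := A) rfl (g := fun _ => 1)]
  · rw [prod_const_one, mul_one]
  · intro i hi
    simp [hi]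
  · intro i hi
    rw [mem_compl] at hi
    simp [hi]

theorem sum_piecewise_left (A : Finset ι) (x : ∀ i, X i) (h : (∀ i, X i) → ℂ) :
    ∑ y, h (A.piecewise y x) =
      (∏ i ∈ Aᶜ, Fintype.card (X i) : ℕ) * ∑ y with ∀ i ∈ Aᶜ, x i = y i, h y := by
  rw [← sum_fiberwise_of_maps_to (s := univ) (t := ({y | ∀ i ∈ Aᶜ, x i = y i} : Finset _))
    (g := fun y => A.piecewise y x), mul_sum]
  · refine sum_congr rfl fun y hy => ?_
    rw [sum_congr rfl (g := fun _ => h y), sum_const, nsmul_eq_mul]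
    · rw [← card_eq_on A y]
      congr 3
      ext z
      simp only [mem_filter, mem_univ, true_and] at hy ⊢
      constructor
      · rintro rfl i hi
        simp [hi]
      · intro hz
        ext i
        by_cases hi : i ∈ A
        · simp [hi, hz i hi]
        · simp [hi, hy i (by simpa using hi)]
    · intro z hz
      rw [(mem_filter.1 hz).2]
  · intro y _
    simp only [mem_filter, mem_univ, true_and, mem_compl]
    intro i hi
    simp [hi]

/-- The reduction of `ψ` to `A` is maximally mixed, with the partial trace written as a sum over
labels of all parties. -/
def IsMixedOn (ψ : (∀ i, X i) → ℂ) (A : Finset ι) : Prop :=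
  ∀ x y, ∑ z, ψ (A.piecewise x z) * star (ψ (A.piecewise y z)) =
    if ∀ i ∈ A, x i = y i then 1 else 0

theorem IsMixedOn.mono [Nonempty (∀ i, X i)] {ψ : (∀ i, X i) → ℂ} {A B : Finset ι}
    (hB : IsMixedOn ψ B) (hAB : A ⊆ B) : IsMixedOn ψ A := by
  intro x y
  -- Freeze the labels on `B \ A` to those of `w`; summing over `w` afterwards traces them out.
  have h1 : ∀ w : ∀ i, X i, ∑ z, ψ (A.piecewise x (B.piecewise w z)) *
      star (ψ (A.piecewise y (B.piecewise w z))) = if ∀ i ∈ A, x i = y i then 1 else 0 := by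
    intro w
    have h := hB (A.piecewise x w) (A.piecewise y w)
    have e : ∀ x z : ∀ i, X i,
        B.piecewise (A.piecewise x w) z = A.piecewise x (B.piecewise w z) := by
      intro x z
      ext i
      by_cases hi : i ∈ A
      · simp [hi, hAB hi]
      · by_cases hi' : i ∈ B <;> simp [hi, hi']
    simp_rw [e] at h
    rw [h]
    refine if_congr ⟨fun h i hi => ?_, fun h i hi => ?_⟩ rfl rfl
    · simpa [hi] using h i (hAB hi)
    · by_cases hi' : i ∈ A
      · simpa [hi'] using h i hi'
      · simp [hi']
  have h2 := sum_sum_piecewise B (fun u => ψ (A.piecewise x u) * star (ψ (A.piecewise y u)))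
  simp_rw [h1] at h2
  rw [sum_const, card_univ, nsmul_eq_mul, nsmul_eq_mul] at h2
  exact (mul_left_cancel₀ (Nat.cast_ne_zero.2 Fintype.card_ne_zero) h2).symm

theorem IsMixedOn.purity_eq [Nonempty (∀ i, X i)] {ψ : (∀ i, X i) → ℂ} {A : Finset ι}
    (hA : IsMixedOn ψ A) : purity ψ A = (∏ i ∈ A, (Fintype.card (X i) : ℂ))⁻¹ := by
  have h := card_sq_mul_purity ψ A
  have e : ∀ x y : ∀ i, X i, (∑ z, ψ (A.piecewise x z) * star (ψ (A.piecewise y z))) *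
      ∑ w, ψ (A.piecewise y w) * star (ψ (A.piecewise x w)) =
      if ∀ i ∈ A, x i = y i then 1 else 0 := by
    intro x y
    rw [hA, hA]
    by_cases hxy : ∀ i ∈ A, x i = y i
    · rw [if_pos hxy, if_pos fun i hi => (hxy i hi).symm, mul_one]
    · rw [if_neg hxy, zero_mul]
  simp_rw [e, sum_boole, card_eq_on, sum_const, card_univ, nsmul_eq_mul] at h
  have hL : (Fintype.card (∀ i, X i) : ℂ) ≠ 0 := Nat.cast_ne_zero.2 Fintype.card_ne_zero
  have hprod : (Fintype.card (∀ i, X i) : ℂ) =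
      (∏ i ∈ Aᶜ, Fintype.card (X i) : ℕ) * ∏ i ∈ A, (Fintype.card (X i) : ℂ) := by
    rw [Fintype.card_pi, ← prod_compl_mul_prod A]
    push_cast
    rfl
  rw [hprod] at h hL
  obtain ⟨h1, h2⟩ := mul_ne_zero_iff.1 hL
  rw [← mul_eq_one_iff_eq_inv₀ h2]
  refine mul_left_cancel₀ (mul_ne_zero hL h1) ?_
  linear_combination h

/-- The projector `|ψ⟩⟨ψ|` averaged over the parties outside `S`, up to a factor. -/
noncomputable def localAverage (ψ : (∀ i, X i) → ℂ) (S : Finset ι)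
    (p : (∀ i, X i) × (∀ i, X i)) : ℂ :=
  if ∀ i ∈ Sᶜ, p.1 i = p.2 i then
    ∑ z, ψ (S.piecewise p.1 z) * star (ψ (S.piecewise p.2 z)) else 0

/-- The two support conditions say that the labels agree off `S ∩ R`. Multiplying by the dimension
of that complement frees `y`; exchanging labels on `S \ R`, then on `R \ S`, turns both partial
traces into traces off `S ∩ R`. -/
theorem gram_localAverage [Nonempty (∀ i, X i)] (ψ : (∀ i, X i) → ℂ) (S R : Finset ι) :
    ∑ p, localAverage ψ S p * star (localAverage ψ R p) =
      Fintype.card (∀ i, X i) *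
        ((∏ i ∈ S ∩ R, (Fintype.card (X i) : ℂ)) * purity ψ (S ∩ R)) := by
  set Q := S ∩ R with hQ
  have hL : (Fintype.card (∀ i, X i) : ℂ) ≠ 0 := Nat.cast_ne_zero.2 Fintype.card_ne_zero
  have hprod : (Fintype.card (∀ i, X i) : ℂ) =
      (∏ i ∈ Qᶜ, Fintype.card (X i) : ℕ) * ∏ i ∈ Q, (Fintype.card (X i) : ℂ) := by
    rw [Fintype.card_pi, ← prod_compl_mul_prod Q]
    push_cast
    rfl
  have hc : ((∏ i ∈ Qᶜ, Fintype.card (X i) : ℕ) : ℂ) ≠ 0 := by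
    rw [hprod] at hL
    exact (mul_ne_zero_iff.1 hL).1
  refine mul_left_cancel₀ hc ?_
  have h1 : ((∏ i ∈ Qᶜ, Fintype.card (X i) : ℕ) : ℂ) * (Fintype.card (∀ i, X i) *
        ((∏ i ∈ Q, (Fintype.card (X i) : ℂ)) * purity ψ Q)) =
      (Fintype.card (∀ i, X i) : ℂ) ^ 2 * purity ψ Q := by
    linear_combination (-Fintype.card (∀ i, X i) * purity ψ Q : ℂ) * hprod
  have h2 : ∀ x y : ∀ i, X i, localAverage ψ S (x, y) * star (localAverage ψ R (x, y)) =
      if ∀ i ∈ Qᶜ, x i = y i then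
        (∑ z, ψ (S.piecewise x z) * star (ψ (S.piecewise y z))) *
          ∑ w, ψ (R.piecewise y w) * star (ψ (R.piecewise x w)) else 0 := by
    intro x y
    have hiff : (∀ i ∈ Qᶜ, x i = y i) ↔ (∀ i ∈ Sᶜ, x i = y i) ∧ ∀ i ∈ Rᶜ, x i = y i := by
      simp only [hQ, compl_inter, mem_union, or_imp, forall_and]
    simp only [localAverage, hiff]
    by_cases hS : ∀ i ∈ Sᶜ, x i = y i
    · by_cases hR : ∀ i ∈ Rᶜ, x i = y i
      · rw [if_pos hS, if_pos hR, if_pos ⟨hS, hR⟩, star_sum]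
        simp_rw [star_mul', star_star, mul_comm]
      · rw [if_neg hR, if_neg (not_and_of_not_right _ hR), star_zero, mul_zero]
    · rw [if_neg hS, if_neg (not_and_of_not_left _ hS), zero_mul]
  rw [h1, card_sq_mul_purity, Fintype.sum_prod_type, mul_sum]
  have h3 : ∀ x : ∀ i, X i, ((∏ i ∈ Qᶜ, Fintype.card (X i) : ℕ) : ℂ) *
      ∑ y, localAverage ψ S (x, y) * star (localAverage ψ R (x, y)) =
      ∑ y, ∑ z, ∑ w,
        ψ (S.piecewise x z) * star (ψ (S.piecewise (Q.piecewise y x) z)) *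
          (ψ (R.piecewise (Q.piecewise y x) w) * star (ψ (R.piecewise x w))) := by
    intro x
    simp_rw [h2, ← sum_filter, ← sum_mul_sum]
    exact (sum_piecewise_left Q x fun y =>
      (∑ z, ψ (S.piecewise x z) * star (ψ (S.piecewise y z))) *
          ∑ w, ψ (R.piecewise y w) * star (ψ (R.piecewise x w))).symm
  simp_rw [h3, sum_mul_sum]
  rw [sum_comm]
  conv_rhs => rw [sum_comm]
  refine sum_congr rfl fun y _ => ?_
  calc _ = ∑ x : ∀ i, X i, ∑ z, ∑ w,
        ψ (Q.piecewise x z) * star (ψ (Q.piecewise y z)) *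
          (ψ (R.piecewise (Q.piecewise y x) w) * star (ψ (R.piecewise x w))) := by
        rw [← sum_piecewise_swap (S \ R)]
        refine sum_congr rfl fun x _ => sum_congr rfl fun z _ => sum_congr rfl fun w _ => ?_
        have e1 : S.piecewise ((S \ R).piecewise z x) ((S \ R).piecewise x z) = Q.piecewise x z := by
          ext i
          by_cases h1 : i ∈ S <;> by_cases h2 : i ∈ R <;> simp [hQ, h1, h2]
        have e2 : S.piecewise (Q.piecewise y ((S \ R).piecewise z x)) 
            ((S \ R).piecewise x z) = Q.piecewise y z := by
          ext i
          by_cases h1 : i ∈ S <;> by_cases h2 : i ∈ R <;> simp [hQ, h1, h2]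
        have e3 : R.piecewise (Q.piecewise y ((S \ R).piecewise z x)) w =
            R.piecewise (Q.piecewise y x) w := by
          ext i
          by_cases h1 : i ∈ S <;> by_cases h2 : i ∈ R <;> simp [hQ, h1, h2]
        have e4 : R.piecewise ((S \ R).piecewise z x) w = R.piecewise x w := by
          ext i
          by_cases h1 : i ∈ S <;> by_cases h2 : i ∈ R <;> simp [h1, h2]
        rw [e1, e2, e3, e4]
    _ = ∑ z, ∑ x : ∀ i, X i, ∑ w,
        ψ (Q.piecewise x z) * star (ψ (Q.piecewise y z)) *
          (ψ (R.piecewise (Q.piecewise y x) w) * star (ψ (R.piecewise x w))) := sum_comm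
    _ = ∑ z, ∑ x : ∀ i, X i, ∑ w,
        ψ (Q.piecewise x z) * star (ψ (Q.piecewise y z)) *
          (ψ (Q.piecewise y w) * star (ψ (Q.piecewise x w))) := by
        refine sum_congr rfl fun z _ => ?_
        rw [← sum_piecewise_swap (R \ S)]
        refine sum_congr rfl fun x _ => sum_congr rfl fun w _ => ?_
        have e1 : Q.piecewise ((R \ S).piecewise w x) z = Q.piecewise x z := by
          ext i
          by_cases h1 : i ∈ S <;> by_cases h2 : i ∈ R <;> simp [hQ, h1, h2]
        have e2 : R.piecewise (Q.piecewise y ((R \ S).piecewise w x)) 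
            ((R \ S).piecewise x w) = Q.piecewise y w := by
          ext i
          by_cases h1 : i ∈ S <;> by_cases h2 : i ∈ R <;> simp [hQ, h1, h2]
        have e3 : R.piecewise ((R \ S).piecewise w x) ((R \ S).piecewise x w) = Q.piecewise x w := by
          ext i
          by_cases h1 : i ∈ S <;> by_cases h2 : i ∈ R <;> simp [hQ, h1, h2]
        rw [e1, e2, e3]
    _ = _ := sum_comm

/-- The weight enumerator of a state is nonnegative. -/
theorem weight_nonneg [Nonempty (∀ i, X i)] (ψ : (∀ i, X i) → ℂ) (T : Finset ι) :
    0 ≤ (∑ S ∈ T.powerset, (-1 : ℂ) ^ #(T \ S) *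
      ((∏ i ∈ S, (Fintype.card (X i) : ℂ)) * purity ψ S)).re := by
  have h := re_sum_sum_nonneg T.powerset (fun S => (-1 : ℝ) ^ #(T \ S)) _ _ (gram_localAverage ψ)
  rw [sum_eq_single_of_mem T (mem_powerset_self T)] at h
  · have e : ∑ S ∈ T.powerset, (((-1 : ℝ) ^ #(T \ T) : ℝ) * ((-1 : ℝ) ^ #(T \ S) : ℝ) : ℂ) *
        (Fintype.card (∀ i, X i) *
          ((∏ i ∈ T ∩ S, (Fintype.card (X i) : ℂ)) * purity ψ (T ∩ S))) =
        Fintype.card (∀ i, X i) • ∑ S ∈ T.powerset, (-1 : ℂ) ^ #(T \ S) *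
          ((∏ i ∈ S, (Fintype.card (X i) : ℂ)) * purity ψ S) := by
      rw [nsmul_eq_mul, mul_sum]
      refine sum_congr rfl fun S hS => ?_
      rw [inter_eq_right.2 (mem_powerset.1 hS)]
      simp
      ring
    rw [e, Complex.re_nsmul, nsmul_eq_mul] at h
    exact (mul_nonneg_iff_of_pos_left (Nat.cast_pos.2 Fintype.card_pos)).1 h
  -- Rows with `S ≠ T` vanish: for `a ∈ T \ S`, the sets `R` and `insert a R` meet `S` equally but
  -- carry opposite signs.
  · intro S hS hST
    obtain ⟨a, haT, haS⟩ := exists_of_ssubset (lt_of_le_of_ne (mem_powerset.1 hS) hST)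
    have hT : T = insert a (T.erase a) := (insert_erase haT).symm
    rw [hT, sum_powerset_insert (notMem_erase a T), ← hT, ← sum_add_distrib]
    refine sum_eq_zero fun R hR => ?_
    have haR : a ∉ R := fun h => notMem_erase a T (mem_powerset.1 hR h)
    have h1 : #(T \ R) = #(T \ insert a R) + 1 := by
      rw [sdiff_insert, card_erase_add_one (by simp [haT, haR])]
    rw [inter_insert_of_notMem haS, h1]
    push_cast
    ring

end Purity
end MultipartiteSystem

namespace MultipartiteSystem

open Finset

/-! ### From uniform states to mixedness on small sets. -/

section Uniform

variable {ι : Type*} [Fintype ι] [DecidableEq ι] {d : ι → ℕ}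

/-- Summing over full labels repeats each partial-trace term once per label of `A`, which cancels
the factor `1 / ∏ i ∈ A, d i`. -/
theorem isMixedOn_of_reduction {ψ : HilbertSpace d} {A : Finset ι}
    (h : reduction (densityMatrix ψ) A = (1 / ∏ i ∈ A, (d i : ℂ)) • 1) :
    IsMixedOn (fun u => ψ u) A := by
  intro x y
  have hd : ∏ i ∈ A, (d i : ℂ) ≠ 0 :=
    prod_ne_zero_iff.2 fun i _ => Nat.cast_ne_zero.2 (Fin.pos (x i)).ne'
  have hglue : ∀ (x : ∀ i, Fin (d i)) (a : (i : {i // i ∈ A}) → Fin (d i))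
      (z : (i : {i // i ∉ A}) → Fin (d i)),
      A.piecewise x (glue A a z) = glue A (fun i => x i) z := by
    intro x a z
    ext i
    by_cases hi : i ∈ A <;> simp [glue, Equiv.piEquivPiSubtypeProd, hi]
  have hentry := congrFun (congrFun h fun i => x i) fun i => y i
  simp only [reduction, densityMatrix, Matrix.of_apply, Matrix.smul_apply, Matrix.one_apply,
    smul_eq_mul] at hentry
  rw [← (Equiv.piEquivPiSubtypeProd (fun i => i ∈ A) (fun i => Fin (d i))).symm.sum_comp,
    Fintype.sum_prod_type]
  change ∑ a, ∑ z, ψ (A.piecewise x (glue A a z)) * star (ψ (A.piecewise y (glue A a z))) = _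
  simp_rw [hglue, hentry]
  rw [sum_const, card_univ, Fintype.card_pi, nsmul_eq_mul]
  simp only [Fintype.card_fin]
  rw [prod_coe_sort A d]
  push_cast
  rw [← mul_assoc, mul_one_div_cancel hd, one_mul]
  refine if_congr ?_ rfl rfl
  rw [funext_iff, Subtype.forall]

theorem IsUniformState.isMixedOn {k : ℕ} {ψ : HilbertSpace d} (hψ : IsUniformState k ψ)
    (hk : k ≤ Fintype.card ι) {A : Finset ι} (hA : #A ≤ k) :
    IsMixedOn (fun u => ψ u) A := by
  obtain ⟨B, hAB, hB⟩ := exists_superset_card_eq hA hk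
  have : Nonempty (∀ i, Fin (d i)) := by
    by_contra hempty
    rw [not_nonempty_iff] at hempty
    have h := hψ.1
    rw [Subsingleton.elim ψ 0, norm_zero] at h
    exact zero_ne_one h
  exact (isMixedOn_of_reduction (hψ.2 B hB)).mono hAB

end Uniform

/-! ### Integer inequalities for AME states with one exceptional party. -/

section OneAndMany

/-- The purity of the reduction of an AME state of `ℂ^d ⊗ (ℂ^D)^{⊗2n}` to `s` of the `D`-dimensional
parties, times `d * D ^ (2 * n)`. -/
def scaledPurity (d D n s : ℕ) : ℤ :=
  if s ≤ n then d * D ^ (2 * n - s) else D ^ s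

variable {d D n : ℕ} {ψ : HilbertSpace (oneAndMany d D (2 * n))}

theorem prod_oneAndMany {m : ℕ} {S : Finset (Fin (m + 1))} (hS : 0 ∉ S) :
    ∏ i ∈ S, (Fintype.card (Fin (oneAndMany d D m i)) : ℂ) = D ^ #S := by
  rw [← prod_const]
  refine prod_congr rfl fun i hi => ?_
  rw [Fintype.card_fin, oneAndMany, if_neg]
  rintro rfl
  exact hS hi

/-- If `S` has more than `n` parties, its complement has at most `n`, including party `0`, and the
same purity. -/
theorem IsAME.purity_eq (hd : 0 < d) (hD : 0 < D) (hψ : IsAME ψ)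
    {S : Finset (Fin (2 * n + 1))} (hS : 0 ∉ S) :
    ((d * D ^ (2 * n) : ℕ) : ℂ) * purity (fun u => ψ u) S = scaledPurity d D n #S := by
  have hk : Fintype.card (Fin (2 * n + 1)) / 2 = n := by
    rw [Fintype.card_fin]
    omega
  have : Nonempty (∀ i, Fin (oneAndMany d D (2 * n) i)) := by
    refine ⟨fun i => ⟨0, ?_⟩⟩
    unfold oneAndMany
    split_ifs <;> assumption
  have hmix : ∀ A : Finset (Fin (2 * n + 1)), #A ≤ n → IsMixedOn (fun u => ψ u) A := by
    intro A hA
    exact IsUniformState.isMixedOn hψ (Nat.div_le_self _ _) (hk.symm ▸ hA)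
  have hd' : (d : ℂ) ≠ 0 := Nat.cast_ne_zero.2 hd.ne'
  have hD' : (D : ℂ) ≠ 0 := Nat.cast_ne_zero.2 hD.ne'
  have hcard := card_compl_add_card S
  rw [Fintype.card_fin] at hcard
  rw [scaledPurity]
  split_ifs with hs
  · rw [(hmix S hs).purity_eq, prod_oneAndMany hS]
    push_cast
    rw [show (D : ℂ) ^ (2 * n) = D ^ (2 * n - #S) * D ^ #S by rw [pow_sub_mul_pow _ (by omega)]]
    field_simp
  · rw [← purity_compl, (hmix Sᶜ (by omega)).purity_eq,
      ← mul_prod_erase _ _ (mem_compl.2 hS), prod_oneAndMany (notMem_erase _ _),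
      card_erase_of_mem (mem_compl.2 hS), Fintype.card_fin]
    have hpos : 0 < #Sᶜ := card_pos.2 ⟨0, mem_compl.2 hS⟩
    have hpow : 2 * n = #S + (#Sᶜ - 1) := by omega
    push_cast
    rw [show (D : ℂ) ^ (2 * n) = D ^ #S * D ^ (#Sᶜ - 1) by rw [← pow_add, ← hpow]]
    simp only [oneAndMany, if_true]
    field_simp

theorem int_nonneg_of_re_nonneg {c : ℕ} {z : ℂ} {m : ℤ} (hz : 0 ≤ z.re) (h : (c : ℂ) * z = m) :
    0 ≤ m := by
  have h' := congrArg Complex.re h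
  rw [← nsmul_eq_mul, Complex.re_nsmul, nsmul_eq_mul, Complex.intCast_re] at h'
  exact_mod_cast h' ▸ mul_nonneg c.cast_nonneg hz

theorem IsAME.weight_nonneg (hd : 0 < d) (hD : 0 < D) (hψ : IsAME ψ) {t : ℕ} (ht : t ≤ 2 * n) :
    0 ≤ ∑ s ∈ range (t + 1), (t.choose s : ℤ) * ((-1) ^ (t - s) * (D ^ s * scaledPurity d D n s)) := by
  have : Nonempty (∀ i, Fin (oneAndMany d D (2 * n) i)) := by
    refine ⟨fun i => ⟨0, ?_⟩⟩
    unfold oneAndMany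
    split_ifs <;> assumption
  obtain ⟨T, hT, rfl⟩ := exists_subset_card_eq
    (s := univ.erase (0 : Fin (2 * n + 1))) (n := t) (by simpa using ht)
  refine int_nonneg_of_re_nonneg (c := d * D ^ (2 * n)) (MultipartiteSystem.weight_nonneg
    (fun u => ψ u) T) ?_
  rw [mul_sum]
  have h := sum_powerset_apply_card (x := T)
    (fun s => (-1 : ℂ) ^ (#T - s) * (D ^ s * scaledPurity d D n s))
  push_cast
  simp only [nsmul_eq_mul] at h
  rw [← h]
  refine sum_congr rfl fun S hS => ?_
  rw [mem_powerset] at hS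
  have h0 : 0 ∉ S := fun h0 => by simpa using hT (hS h0)
  rw [prod_oneAndMany h0, card_sdiff_of_subset hS, ← hψ.purity_eq hd hD h0]
  push_cast
  ring

theorem IsAME.sum_shadow_nonneg (hd : 0 < d) (hD : 0 < D) (hψ : IsAME ψ)
    {U T : Finset (Fin (2 * n + 1))} (hU : 0 ∉ U) :
    0 ≤ ∑ S ∈ U.powerset, (-1) ^ #(S ∩ T) * scaledPurity d D n #S := by
  refine int_nonneg_of_re_nonneg (c := d * D ^ (2 * n)) (shadow_nonneg (fun u => ψ u) U T) ?_
  rw [mul_sum]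
  push_cast
  refine sum_congr rfl fun S hS => ?_
  rw [← hψ.purity_eq hd hD fun h => hU (mem_powerset.1 hS h)]
  push_cast
  ring

theorem IsAME.shadow_zero (hd : 0 < d) (hD : 0 < D) (hψ : IsAME ψ) :
    0 ≤ ∑ s ∈ range (2 * n + 1), ((2 * n).choose s : ℤ) * ((-1) ^ s * scaledPurity d D n s) := by
  have h := hψ.sum_shadow_nonneg hd hD (T := univ.erase 0) (notMem_erase 0 univ)
  rw [sum_congr rfl (g := fun S => (-1) ^ #S * scaledPurity d D n #S)
    fun S hS => by rw [inter_eq_left.2 (mem_powerset.1 hS)],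
    sum_powerset_apply_card (fun s => (-1) ^ s * scaledPurity d D n s)] at h
  simpa using h

/-- One party of `U` lies outside `T`, so adding it to `S` leaves the sign unchanged. In
`shadow_two` there are two such parties. -/
theorem IsAME.shadow_one (hd : 0 < d) (hD : 0 < D) (hψ : IsAME ψ) (hn : 0 < n) :
    0 ≤ ∑ s ∈ range (2 * n), ((2 * n - 1).choose s : ℤ) *
      ((-1) ^ s * (scaledPurity d D n s + scaledPurity d D n (s + 1))) := by
  obtain ⟨T, hT, hTc⟩ := exists_subset_card_eq
    (s := univ.erase (0 : Fin (2 * n + 1))) (n := 2 * n - 1) (by simp)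
  obtain ⟨a, ha⟩ : ∃ a, a ∈ (univ.erase (0 : Fin (2 * n + 1))) \ T := by
    rw [← Finset.Nonempty, ← card_pos, card_sdiff_of_subset hT, hTc]
    simp
    omega
  rw [mem_sdiff] at ha
  have h0 : 0 ∉ insert a T := fun h0 => by
    simpa using insert_subset ha.1 hT h0
  have h := hψ.sum_shadow_nonneg hd hD (T := T) h0
  rw [sum_powerset_insert ha.2, ← sum_add_distrib, sum_congr rfl (g := fun S => (-1) ^ #S *
    (scaledPurity d D n #S + scaledPurity d D n (#S + 1))),
    sum_powerset_apply_card
      (fun s => (-1) ^ s * (scaledPurity d D n s + scaledPurity d D n (s + 1))), hTc,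
    Nat.sub_add_cancel (by omega)] at h
  · simpa using h
  · intro S hS
    rw [mem_powerset] at hS
    rw [insert_inter_of_notMem ha.2, inter_eq_left.2 hS, card_insert_of_notMem fun h => ha.2 (hS h)]
    ring

theorem IsAME.shadow_two (hd : 0 < d) (hD : 0 < D) (hψ : IsAME ψ) (hn : 0 < n) :
    0 ≤ ∑ s ∈ range (2 * n - 1), ((2 * n - 2).choose s : ℤ) *
      ((-1) ^ s * (scaledPurity d D n s + 2 * scaledPurity d D n (s + 1) +
        scaledPurity d D n (s + 2))) := by
  obtain ⟨T, hT, hTc⟩ := exists_subset_card_eq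
    (s := univ.erase (0 : Fin (2 * n + 1))) (n := 2 * n - 2) (by simp)
  obtain ⟨a, b, hab, hV⟩ : ∃ a b, a ≠ b ∧ (univ.erase (0 : Fin (2 * n + 1))) \ T = {a, b} := by
    rw [← card_eq_two, card_sdiff_of_subset hT, hTc]
    simp
    omega
  have ha : a ∈ univ.erase 0 \ T := by simp [hV]
  have hb : b ∈ univ.erase 0 \ T := by simp [hV]
  rw [mem_sdiff] at ha hb
  have hbT : b ∉ insert a T := by simp [hb.2, hab.symm]
  have h0 : 0 ∉ insert b (insert a T) := fun h0 => by
    simpa using insert_subset hb.1 (insert_subset ha.1 hT) h0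
  have h := hψ.sum_shadow_nonneg hd hD (T := T) h0
  rw [sum_powerset_insert hbT, ← sum_add_distrib, sum_powerset_insert ha.2, ← sum_add_distrib,
    sum_congr rfl (g := fun S => (-1) ^ #S *
    (scaledPurity d D n #S + 2 * scaledPurity d D n (#S + 1) + scaledPurity d D n (#S + 2))),
    sum_powerset_apply_card
      (fun s => (-1) ^ s * (scaledPurity d D n s + 2 * scaledPurity d D n (s + 1) +
        scaledPurity d D n (s + 2))), hTc, show 2 * n - 2 + 1 = 2 * n - 1 by omega] at h
  · simpa using h
  · intro S hS
    rw [mem_powerset] at hS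
    have haS : a ∉ S := fun h => ha.2 (hS h)
    have hbS : b ∉ S := fun h => hb.2 (hS h)
    have hbS' : b ∉ insert a S := by simp [hbS, hab.symm]
    rw [insert_inter_of_notMem hb.2, insert_inter_of_notMem hb.2, insert_inter_of_notMem ha.2,
      inter_eq_left.2 hS, card_insert_of_notMem hbS', card_insert_of_notMem haS,
      card_insert_of_notMem hbS]
    ring

theorem sum_choose_mul_neg_one_pow {t : ℕ} (ht : t ≠ 0) :
    ∑ s ∈ range (t + 1), (t.choose s : ℤ) * (-1) ^ (t - s) = 0 := by
  rw [← sum_range_reflect, ← Int.alternating_sum_range_choose_of_ne ht]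
  refine sum_congr rfl fun s hs => ?_
  rw [mem_range] at hs
  rw [show t + 1 - 1 - s = t - s by omega, Nat.choose_symm (by omega),
    show t - (t - s) = s by omega, mul_comm]

/-- For `s ≤ n` the summand `D ^ s * scaledPurity d D n s` is the constant `d * D ^ (2 * n)`.
Subtracting this constant throughout costs nothing, as its alternating binomial sum is zero, and
leaves only `s > n`. -/
theorem sum_weight_eq {t : ℕ} (k : ℕ) (hk : t = n + k) (hk0 : 0 < k) :
    ∑ s ∈ range (t + 1), (t.choose s : ℤ) * ((-1) ^ (t - s) * (D ^ s * scaledPurity d D n s)) =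
      D ^ (2 * n) * ∑ j ∈ range k, ((n + k).choose (n + 1 + j) : ℤ) *
        ((-1) ^ (k - (j + 1)) * (D ^ (2 * (j + 1)) - d)) := by
  subst hk
  have h : ∑ s ∈ range (n + k + 1), ((n + k).choose s : ℤ) *
      ((-1) ^ (n + k - s) * (D ^ s * scaledPurity d D n s)) =
      ∑ s ∈ range (n + k + 1), ((n + k).choose s : ℤ) *
      ((-1) ^ (n + k - s) * (D ^ s * scaledPurity d D n s - d * D ^ (2 * n))) := by
    rw [← sub_eq_zero, ← sum_sub_distrib]
    have h0 := sum_choose_mul_neg_one_pow (t := n + k) (by omega)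
    rw [← mul_zero (d * D ^ (2 * n) : ℤ), ← h0, mul_sum]
    refine sum_congr rfl fun s _ => ?_
    ring
  rw [h, show n + k + 1 = n + 1 + k by ring, sum_range_add, sum_eq_zero, zero_add, mul_sum]
  · refine sum_congr rfl fun j hj => ?_
    rw [mem_range] at hj
    rw [scaledPurity, if_neg (by omega), show n + k - (n + 1 + j) = k - (j + 1) by omega]
    ring
  · intro s hs
    rw [mem_range] at hs
    rw [scaledPurity, if_pos (by omega), show 2 * n = (2 * n - s) + s by omega, pow_add,
      Nat.add_sub_cancel]
    ring

theorem IsAME.weight_add_two (hd : 0 < d) (hD : 0 < D) (hψ : IsAME ψ) (hn : 2 ≤ n) :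
    (0 : ℤ) ≤ D ^ 4 - d - (n + 2) * (D ^ 2 - d) := by
  have h := hψ.weight_nonneg hd hD (t := n + 2) (by omega)
  rw [sum_weight_eq 2 rfl two_pos, mul_nonneg_iff_of_pos_left (by positivity)] at h
  rw [sum_range_succ, sum_range_one, show n + 1 + 0 = n + 1 by ring, show n + 1 + 1 = n + 2 by ring,
    Nat.choose_self, Nat.choose_succ_self_right] at h
  push_cast at h
  linarith

theorem IsAME.weight_add_three (hd : 0 < d) (hD : 0 < D) (hψ : IsAME ψ) (hn : 3 ≤ n) :
    (0 : ℤ) ≤ 2 * (D ^ 6 - d) - 2 * (n + 3) * (D ^ 4 - d) + (n + 3) * (n + 2) * (D ^ 2 - d) := by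
  have h := hψ.weight_nonneg hd hD (t := n + 3) (by omega)
  rw [sum_weight_eq 3 rfl three_pos, mul_nonneg_iff_of_pos_left (by positivity)] at h
  have hc : ((n + 3).choose (n + 1) : ℤ) * 2 = (n + 3) * (n + 2) := by
    rw [Nat.choose_symm_of_eq_add (show n + 3 = n + 1 + 2 by ring)]
    have := Nat.add_one_mul_choose_eq (n + 2) 1
    rw [Nat.choose_one_right] at this
    exact_mod_cast this.symm
  rw [sum_range_succ, sum_range_succ, sum_range_one, show n + 1 + 0 = n + 1 by ring,
    show n + 1 + 1 = n + 2 by ring, show n + 1 + 2 = n + 3 by ring, Nat.choose_self,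
    Nat.choose_succ_self_right] at h
  push_cast at h
  linear_combination 2 * h + (D ^ 2 - d : ℤ) * hc

end OneAndMany
end MultipartiteSystem

/-! ### Elimination of the remaining values of `n`. -/

open MultipartiteSystem in
theorem mainTheorem5 :
    (∀ d n : ℕ, (d = 3 ∨ d = 4) → 4 ≤ n →
      ¬ ∃ ψ : MultipartiteSystem.HilbertSpace (MultipartiteSystem.oneAndMany d 2 (2 * n)),
        MultipartiteSystem.IsAME ψ) ∧
    (∀ d n : ℕ, 2 ≤ d → d ≤ 8 → d ≠ 3 → 6 ≤ n → n ≠ 7 →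
      ¬ ∃ ψ : MultipartiteSystem.HilbertSpace (MultipartiteSystem.oneAndMany d 3 (2 * n)),
        MultipartiteSystem.IsAME ψ) ∧
    (∀ n : ℕ, 6 ≤ n → n ≠ 7 → n ≠ 9 →
      ¬ ∃ ψ : MultipartiteSystem.HilbertSpace (MultipartiteSystem.oneAndMany 9 3 (2 * n)),
        MultipartiteSystem.IsAME ψ) := by
  refine ⟨?_, ?_, ?_⟩
  · rintro d n hd hn ⟨ψ, hψ⟩
    have h2 := hψ.weight_add_two (by omega) two_pos (by omega)
    have h3 := hψ.weight_add_three (by omega) two_pos (by omega)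
    rcases hd with rfl | rfl
    -- Here `h3` reads `n ^ 2 - 21 * n + 50 ≥ 0`, which fails for `3 ≤ n ≤ 18`.
    · have : n ≤ 11 := by push_cast at h2; omega
      push_cast at h3
      nlinarith
    -- Since `D ^ 2 = d`, the quadratic term of `h3` disappears and `n ≤ 2` remains.
    · push_cast at h3
      linarith
  · rintro d n hd hd' hd3 hn hn7 ⟨ψ, hψ⟩
    have h2 := hψ.weight_add_two (by omega) three_pos (by omega)
    have h3 := hψ.weight_add_three (by omega) three_pos (by omega)
    have s0 := hψ.shadow_zero (by omega) three_pos
    have s1 := hψ.shadow_one (by omega) three_pos (by omega)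
    have s2 := hψ.shadow_two (by omega) three_pos (by omega)
    clear hψ ψ
    interval_cases d <;> push_cast at h2 h3
    · have : n ≤ 9 := by omega
      interval_cases n
      exacts [absurd s1 (by decide +kernel), hn7 rfl, absurd s1 (by decide +kernel),
        absurd s2 (by decide +kernel)]
    · exact hd3 rfl
    · have : n ≤ 13 := by omega
      interval_cases n
      exacts [absurd s1 (by decide +kernel), hn7 rfl, absurd s1 (by decide +kernel),
        absurd s0 (by decide +kernel), absurd s1 (by decide +kernel),
        absurd s0 (by decide +kernel), absurd s1 (by decide +kernel),
        absurd s0 (by decide +kernel)]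
    · have : n ≤ 17 := by omega
      -- The quadratic in `h3` is negative between its roots, and the bound from `h2` lies below the
      -- larger one. The same happens for `d = 6, 7, 8`.
      have : n ≤ 12 := by
        by_contra! h
        nlinarith
      interval_cases n
      exacts [absurd s1 (by decide +kernel), hn7 rfl, absurd s1 (by decide +kernel),
        absurd s0 (by decide +kernel), absurd s1 (by decide +kernel),
        absurd s0 (by decide +kernel), absurd s1 (by decide +kernel)]
    · have : n ≤ 23 := by omega
      have : n ≤ 9 := by
        by_contra! h
        nlinarith
      interval_cases n
      exacts [absurd s1 (by decide +kernel), hn7 rfl, absurd s1 (by decide +kernel),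
        absurd s0 (by decide +kernel)]
    · have : n ≤ 35 := by omega
      have : n ≤ 8 := by
        by_contra! h
        nlinarith
      interval_cases n
      exacts [absurd s1 (by decide +kernel), hn7 rfl, absurd s1 (by decide +kernel)]
    · have : n ≤ 71 := by omega
      have : n ≤ 7 := by
        by_contra! h
        nlinarith
      interval_cases n
      exacts [absurd s1 (by decide +kernel), hn7 rfl]
  · rintro n hn hn7 hn9 ⟨ψ, hψ⟩
    have h3 := hψ.weight_add_three (by omega) three_pos (by omega)
    have s1 := hψ.shadow_one (by omega) three_pos (by omega)
    clear hψ ψ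
    obtain rfl | hn8 : n = 6 ∨ 8 ≤ n := by omega
    · revert s1
      decide +kernel
    -- Again `D ^ 2 = d`, and `h3` reduces to `n ≤ 7`.
    · push_cast at h3
      linarith
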